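/- **Setting.** Let $n,\Delta\ge 0$ be integers. A *network* is a graph whose vertices have distinct IDs in $\{0,\dots,n-1\}$ (not every ID has to be in use) and whose maximum degree is at most $\Delta$. Computation proceeds in synchronous rounds; $n$, $\Delta$ and the ID are read-only data of each vertex. The changeable memory (RAM) of a vertex $v$ holds a color from a finite palette and one bit $\mu_v$; in each round $v$ receives the color and the bit of each of its neighbors and then updates its own. In a *fault-free* round the network does not change and every vertex executes the algorithm below; in any other round the network (vertices and edges) may change arbitrarily, within the bounds $n$ and $\Delta$, and so may the RAM of all vertices. **Palette.** Let $q$ be the least prime larger than $8(\Delta+1)$. Put $m_0=n$ and $m_{i+1}=q_i^2$, where $d_i=\lceil\log_2 m_i\rceil$ (with $d_i=0$ if $m_i\le 1$) and $q_i$ is the least prime larger than $d_i\Delta$. Let $k$ be the least index with $m_k\le(8(\Delta+1))^3$ and let $r=k+1$. The palette $\{0,1,\dots\}$ is partitioned into consecutive intervals $I_0,I_1,\dots,I_r$ with $|I_0|=q^2$ and $|I_{r-i}|=m_i$ for $0\le i\le k$. A color of $I_0$ is written as $aq+b=\langle a,b\rangle$ with $0\le a,b<q$. **Coloring step** (Self-Stabilizing-Coloring).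 If the color of $v$ equals the color of a neighbor, then $v$ with ID $id$ takes the $id$-th color of $I_r$ (counting from $0$). Otherwise let $I_j$ be the interval of the color of $v$ and let $Q$ be the set of the neighbors' colors in $I_j$. * If $j\ge 1$, then $v$ makes an iteration of Linial's algorithm from $I_j$ to $I_{j-1}$. The $c$-th color of $I_j$ is assigned the polynomial $g_c$ over $GF(p)$ whose coefficients in degrees $0,\dots,d$ are the base-$p$ digits of $c$, where $p=q_{r-j}$, $d=d_{r-j}$ if $j\ge 2$, and $p=q$, $d=2$ if $j=1$. With $c$ the position of the color of $v$ in $I_j$, the vertex $v$ takes the color of $I_{j-1}$ at position $xp+g_c(x)$ for the first $x\in\{0,\dots,p-1\}$ such that $g_c(x)\ne g_{c'}(x)$ for all colors of $Q$ (at positions $c'$) and, if $j=1$, such that the new color is none of $\langle a,(a+b)\bmod q\rangle$, $\langle 0,b\rangle$ for the colors $\langle a,b\rangle\in I_0$ of neighbors of $v$. * If $j=0$ and the color of $v$ is $\langle a,b\rangle$, then the new color is $\langle a,(a+b)\bmod q\rangle$ if some neighbor has a color $\langle a',b\rangle\in I_0$, and $\langle 0,b\rangle$ otherwise. **MIS step.**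 At the end of the round $v$ sets $\mu_v=1$ if every neighbor $u$ whose (received) color is smaller than the new color of $v$ has (received) bit $\mu_u=0$, and $\mu_v=0$ otherwise. **Theorem.** This is a self-stabilizing maximal independent set algorithm with stabilization time $O(\Delta+\log^* n)$. That is, there is an absolute constant $C$ such that for all $n$, $\Delta$ and every execution, if all rounds from time $T$ on are fault-free (with arbitrary contents of the RAM at time $T$), then there is a maximal independent set $U$ of the network present from time $T$ on such that at every time $t\ge T+C(\Delta+\log^* n+1)$ the set of the vertices $v$ with $\mu_v=1$ is equal to $U$. Here $\log^* n$ is the number of times $\log_2$ has to be applied, starting from $n$, until the result is smaller than $2$. -/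

import Mathlib

namespace SelfStab

/-- `log* x`: the number of times `log₂` has to be applied, starting from `x`, until the
result is smaller than `2`. -/
noncomputable def logStar (x : ℝ) : ℕ :=
  sInf {k : ℕ | (Real.logb 2)^[k] x < 2}

theorem exists_prime_gt (N : ℕ) : ∃ p : ℕ, N < p ∧ p.Prime := by
  obtain ⟨p, h, hp⟩ := Nat.exists_infinite_primes (N + 1)
  exact ⟨p, h, hp⟩

/-- The least prime larger than `N`. -/
def primeAbove (N : ℕ) : ℕ := Nat.find (exists_prime_gt N)

/-! ### Parameters: fields and palettes of the iterations of Linial's algorithm -/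

/-- Degree of the polynomials in a non-final iteration that starts from `m` colors. -/
def linialDegree (m : ℕ) : ℕ := Nat.clog 2 m

/-- Size of the prime field in a non-final iteration that starts from `m` colors: the least
prime exceeding (degree) · `Δ`, where `Δ` is the degree bound of the graph. -/
def linialField (Δ m : ℕ) : ℕ := primeAbove (linialDegree m * Δ)

/-- Number of colors after `i` non-final iterations, starting from the `n` colors given by the
IDs. An iteration over a field of size `q` yields pairs `⟨x, g(x)⟩`, that is, `q ^ 2` colors. -/
def palette (n Δ : ℕ) : ℕ → ℕ
  | 0 => n
  | i + 1 => linialField Δ (palette n Δ i) ^ 2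

/-- The prime `q = Θ(Δ)` of the Additive-Group step; it also is the size of the field in the
final iteration of Linial's algorithm, where the polynomials have degree `2`. -/
def agField (Δ : ℕ) : ℕ := primeAbove (8 * (Δ + 1))

/-- The number `r` of iterations of Linial's algorithm: non-final iterations are made until the
number of colors is at most `(8 (Δ + 1)) ^ 3 = O(Δ³)`, then there is one final iteration. -/
noncomputable def numIters (n Δ : ℕ) : ℕ :=
  sInf {k : ℕ | palette n Δ k ≤ (8 * (Δ + 1)) ^ 3} + 1

/-- The size of the interval `I_j`, `0 ≤ j ≤ r`. The interval `I_r` holds the `n` initial colors,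
the interval `I_{r - i}` holds the palette after `i` iterations. -/
noncomputable def intervalSize (n Δ j : ℕ) : ℕ :=
  if j = 0 then agField Δ ^ 2 else palette n Δ (numIters n Δ - j)

/-- The first element of the interval `I_j`. -/
noncomputable def intervalStart (n Δ j : ℕ) : ℕ :=
  ∑ i ∈ Finset.range j, intervalSize n Δ i

/-- The number of all colors, i.e. the size of `I_0 ∪ ... ∪ I_r`. -/
noncomputable def numColors (n Δ : ℕ) : ℕ := intervalStart n Δ (numIters n Δ + 1)

/-- The index `j` of the interval `I_j` that contains the color `c`. -/
noncomputable def intervalIndex (n Δ c : ℕ) : ℕ :=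
  Nat.findGreatest (fun j => intervalStart n Δ j ≤ c) (numIters n Δ)

/-- Degree of the polynomials in the iteration that leads from `I_j` to `I_{j - 1}`. -/
noncomputable def levelDegree (n Δ j : ℕ) : ℕ :=
  if j = 1 then 2 else linialDegree (intervalSize n Δ j)

/-- Size of the field in the iteration that leads from `I_j` to `I_{j - 1}`. -/
noncomputable def levelField (n Δ j : ℕ) : ℕ :=
  if j = 1 then agField Δ else linialField Δ (intervalSize n Δ j)

/-! ### Algorithm Mod-Linial -/

/-- The value at `x` of the polynomial `g_c` over `GF(q)`, of degree at most `d`, whose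
coefficients are the base-`q` digits of `c`. -/
def linialPoly (q d c x : ℕ) : ℕ :=
  (∑ i ∈ Finset.range (d + 1), (c / q ^ i % q) * x ^ i) % q

/-- The color encoded by the pair `⟨a, b⟩` (over a field of size `q`). -/
def pairColor (q a b : ℕ) : ℕ := a * q + b

/-- Algorithm Mod-Linial: a vertex of color `my` in `I_j`, whose neighbors have the colors `Q`
inside `I_j`, moves to the color of `I_{j - 1}` that corresponds to the pair `⟨x, g(x)⟩`, where
`x` is the first field element such that `g(x)` differs from the values at `x` of the polynomials
of the colors in `Q` and such that the new color is not in the set `R` of forbidden colors. -/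
noncomputable def modLinial (n Δ my : ℕ) (Q R : Finset ℕ) : ℕ :=
  let j := intervalIndex n Δ my
  let q := levelField n Δ j
  let g : ℕ → ℕ → ℕ := fun c x => linialPoly q (levelDegree n Δ j) (c - intervalStart n Δ j) x
  let new : ℕ → ℕ := fun x => intervalStart n Δ (j - 1) + pairColor q x (g my x)
  new (sInf {x : ℕ | x < q ∧ (∀ c ∈ Q, g my x ≠ g c x) ∧ new x ∉ R})

/-! ### Procedure Self-Stabilizing-Coloring -/

/-- The initial color of the vertex with a given ID. -/
noncomputable def initialColor (n Δ id : ℕ) : ℕ := intervalStart n Δ (numIters n Δ) + id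

/-- For a color `⟨a, b⟩` of `I_0`: the color `⟨a, (a + b) mod q⟩`. -/
def agShift (Δ c : ℕ) : ℕ :=
  pairColor (agField Δ) (c / agField Δ) ((c / agField Δ + c % agField Δ) % agField Δ)

/-- For a color `⟨a, b⟩` of `I_0`: the final color `⟨0, b⟩`. -/
def agFinal (Δ c : ℕ) : ℕ := pairColor (agField Δ) 0 (c % agField Δ)

/-- Procedure Self-Stabilizing-Coloring: the new color of the vertex with ID `id` and current
color `my`, given the set of the current colors of its neighbors. -/
noncomputable def selfStabilizingColoring (n Δ id my : ℕ) (nbrs : Finset ℕ) : ℕ :=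
  if my ∈ nbrs then initialColor n Δ id
  else
    let j := intervalIndex n Δ my
    let Q := nbrs.filter (fun c => intervalIndex n Δ c = j)
    if 2 ≤ j then modLinial n Δ my Q ∅
    else if j = 1 then
      let S := nbrs.filter (fun c => intervalIndex n Δ c = 0)
      modLinial n Δ my Q (S.image (agShift Δ) ∪ S.image (agFinal Δ))
    else if ∃ c ∈ Q, c % agField Δ = my % agField Δ then agShift Δ my
    else agFinal Δ my

/-! The new color is again one of the `numColors n Δ` colors. -/

theorem primeAbove_pos (N : ℕ) : 0 < primeAbove N :=
  (Nat.find_spec (exists_prime_gt N)).2.pos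

theorem agField_pos (Δ : ℕ) : 0 < agField Δ := primeAbove_pos _

theorem pairColor_lt {q a b : ℕ} (ha : a < q) (hb : b < q) : pairColor q a b < q ^ 2 := by
  unfold pairColor
  nlinarith

theorem intervalStart_mono (n Δ : ℕ) : Monotone (intervalStart n Δ) := fun _ _ h =>
  Finset.sum_le_sum_of_subset (Finset.range_mono h)

theorem sq_agField_le_numColors (n Δ : ℕ) : agField Δ ^ 2 ≤ numColors n Δ := by
  have h : intervalStart n Δ 1 ≤ numColors n Δ := intervalStart_mono n Δ (by omega)
  simpa [intervalStart, intervalSize] using h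

theorem intervalIndex_le (n Δ c : ℕ) : intervalIndex n Δ c ≤ numIters n Δ :=
  Nat.findGreatest_le _

theorem intervalSize_pred (n Δ j : ℕ) (h1 : 1 ≤ j) (hr : j ≤ numIters n Δ) :
    intervalSize n Δ (j - 1) = levelField n Δ j ^ 2 := by
  rcases Nat.eq_or_lt_of_le h1 with h | h
  · subst h; simp [intervalSize, levelField]
  · have e : numIters n Δ - (j - 1) = (numIters n Δ - j) + 1 := by omega
    have h2 : j - 1 ≠ 0 := by omega
    have h3 : j ≠ 1 := by omega
    have h4 : j ≠ 0 := by omega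
    simp [intervalSize, levelField, h2, h3, h4, e, palette]

theorem modLinial_lt (n Δ my : ℕ) (Q R : Finset ℕ) (h : 1 ≤ intervalIndex n Δ my) :
    modLinial n Δ my Q R < numColors n Δ := by
  unfold modLinial
  extract_lets j q g new
  have hq : 0 < q := by
    change 0 < levelField n Δ j
    unfold levelField
    split_ifs
    · exact agField_pos Δ
    · exact primeAbove_pos _
  set A := {x : ℕ | x < q ∧ (∀ c ∈ Q, g my x ≠ g c x) ∧ new x ∉ R} with hA
  have hx : sInf A < q := by
    rcases A.eq_empty_or_nonempty with h0 | h0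
    · rw [h0, Nat.sInf_empty]; exact hq
    · exact (Nat.sInf_mem h0).1
  have hj : j ≤ numIters n Δ := intervalIndex_le n Δ my
  have h2 : pairColor q (sInf A) (g my (sInf A)) < q ^ 2 := pairColor_lt hx (Nat.mod_lt _ hq)
  have h3 : intervalStart n Δ j = intervalStart n Δ (j - 1) + q ^ 2 := by
    obtain ⟨i, hi⟩ : ∃ i, j = i + 1 := ⟨j - 1, by omega⟩
    have := intervalSize_pred n Δ j h hj
    rw [hi] at this ⊢
    rw [intervalStart, Finset.sum_range_succ, ← intervalStart]
    simp only [Nat.add_sub_cancel] at this ⊢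
    rw [this, ← hi]
  have h4 : intervalStart n Δ j ≤ numColors n Δ := intervalStart_mono n Δ (by omega)
  change intervalStart n Δ (j - 1) + pairColor q (sInf A) (g my (sInf A)) < numColors n Δ
  omega

theorem lt_of_intervalIndex_eq_zero (n Δ my : ℕ) (h : intervalIndex n Δ my = 0) :
    my < agField Δ ^ 2 := by
  have h1 := (Nat.findGreatest_eq_zero_iff.1 h) (n := 1) (by omega) (by unfold numIters; omega)
  simpa [intervalStart, intervalSize] using h1

theorem selfStabilizingColoring_lt (n Δ : ℕ) (id : Fin n) (my : ℕ) (nbrs : Finset ℕ) :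
    selfStabilizingColoring n Δ id my nbrs < numColors n Δ := by
  unfold selfStabilizingColoring
  have hq := agField_pos Δ
  have hle := sq_agField_le_numColors n Δ
  split_ifs with h0
  · have hr : numIters n Δ ≠ 0 := by unfold numIters; omega
    have h1 : numColors n Δ = intervalStart n Δ (numIters n Δ) + n := by
      unfold numColors
      rw [intervalStart, Finset.sum_range_succ, ← intervalStart]
      simp [intervalSize, hr, palette]
    have := id.isLt
    unfold initialColor
    omega
  · extract_lets j Q S
    split_ifs with h1 h2 h3
    · exact modLinial_lt n Δ my _ _ (by omega)
    · exact modLinial_lt n Δ my _ _ (by omega)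
    · have hm := lt_of_intervalIndex_eq_zero n Δ my (by omega)
      refine lt_of_lt_of_le (pairColor_lt ?_ (Nat.mod_lt _ hq)) hle
      exact Nat.div_lt_of_lt_mul (by rw [← sq]; exact hm)
    · exact lt_of_lt_of_le (pairColor_lt hq (Nat.mod_lt _ hq)) hle

/-! ### The self-stabilizing MIS algorithm -/

/-- The RAM of a vertex: its color and the bit `μ` (`true` means that the vertex is in the
MIS). -/
structure RAM (n Δ : ℕ) where
  color : Fin (numColors n Δ)
  mu : Bool

/-- One round of the self-stabilizing MIS algorithm at the vertex with ID `id`; `msgs` is the set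
of the pairs (color, `μ`) received from the neighbors. Procedure Self-Stabilizing-Coloring is
executed, and at its end `μ` is set to `1` if and only if all neighbors of smaller color have
`μ = 0`. -/
noncomputable def misRound {n Δ : ℕ} (id : Fin n) (own : RAM n Δ) (msgs : Finset (ℕ × Bool)) :
    RAM n Δ :=
  let new : ℕ := selfStabilizingColoring n Δ id own.color (msgs.image Prod.fst)
  { color := ⟨new, selfStabilizingColoring_lt n Δ id own.color (msgs.image Prod.fst)⟩
    mu := decide (∀ m ∈ msgs, m.1 < new → m.2 = false) }

/-! ### Networks, executions and faults -/

/-- A network whose vertices have distinct IDs in `{0, ..., n - 1}` (a vertex is identified with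
its ID; not every ID has to be in use) and with maximum degree at most `Δ`. -/
structure Network (n Δ : ℕ) where
  verts : Set (Fin n)
  graph : SimpleGraph (Fin n)
  mem_verts_of_adj : ∀ u v, graph.Adj u v → u ∈ verts
  degree_le : ∀ v, (graph.neighborSet v).ncard ≤ Δ

open Classical in
/-- The messages that `v` receives in a round: the contents of the RAM of each neighbor. -/
noncomputable def received {n Δ : ℕ} (G : Network n Δ) (s : Fin n → RAM n Δ) (v : Fin n) :
    Finset (ℕ × Bool) :=
  (Finset.univ.filter (fun u => G.graph.Adj v u)).image (fun u => ((s u).color.val, (s u).mu))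

/-- In round `t` of an execution with topologies `G` and RAM contents `s` there is no fault and
no dynamic update: the topology stays the same and every vertex executes the algorithm. -/
def FaultFree {n Δ : ℕ} (G : ℕ → Network n Δ) (s : ℕ → Fin n → RAM n Δ) (t : ℕ) : Prop :=
  G (t + 1) = G t ∧
    ∀ v ∈ (G t).verts, s (t + 1) v = misRound v (s t v) (received (G t) (s t) v)

/-- `U` is a maximal independent set of the network `G`. -/
def IsMIS {n Δ : ℕ} (G : Network n Δ) (U : Set (Fin n)) : Prop :=
  U ⊆ G.verts ∧ (∀ u ∈ U, ∀ v ∈ U, ¬ G.graph.Adj u v) ∧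
    ∀ v ∈ G.verts, v ∉ U → ∃ u ∈ U, G.graph.Adj v u

/-- The set of the vertices of the network whose bit `μ` is `1`. -/
def misOutput {n Δ : ℕ} (G : Network n Δ) (s : Fin n → RAM n Δ) : Set (Fin n) :=
  {v | v ∈ G.verts ∧ (s v).mu = true}

end SelfStab

/-! ### Primes and digit polynomials over GF(q) -/

namespace SelfStab

/-! One fault-free round makes the coloring proper, whatever the RAM held before
(`selfStabilizingColoring_ne`): resetting vertices are separated by their IDs, Linial's iteration
and the Additive-Group rule separate neighbors inside an interval, and the step from `I_1` into
`I_0` avoids both possible next colors of each neighbor in `I_0`. Hence nobody resets afterwards,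
every vertex descends one interval per round, and after `r + 1` rounds all colors lie in `I_0`.

In `I_0` a vertex with `a ≠ 0` cycles through `⟨a, b + ka⟩` until it meets no conflict in the second
coordinate. As `q` is prime, two properly colored neighbors conflict at most once within `q` rounds
while both keep their first coordinates. A neighbor can therefore delay a vertex at most twice, once
before and once after becoming final, so `2Δ + 1` rounds suffice (`div_agField_eq_zero_of_proper`).

Then the coloring is proper and constant with `q = O(Δ)` colors. The bits are a greedy MIS in color
order and settle color by color within `q` rounds (`mu_stable_of_color_lt`). It remains to bound `r`
by `log* n + O(1)` (`exists_palette_le`). -/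

theorem primeAbove_prime (N : ℕ) : (primeAbove N).Prime := (Nat.find_spec (exists_prime_gt N)).2

theorem lt_primeAbove (N : ℕ) : N < primeAbove N := (Nat.find_spec (exists_prime_gt N)).1

/-- Bertrand's postulate for the least prime above `N`. -/
theorem primeAbove_le_two_mul {N : ℕ} (hN : N ≠ 0) : primeAbove N ≤ 2 * N := by
  obtain ⟨p, hp, h1, h2⟩ := Nat.exists_prime_lt_and_le_two_mul N hN
  exact (Nat.find_min' (exists_prime_gt N) ⟨h1, hp⟩).trans h2

theorem primeAbove_zero : primeAbove 0 = 2 :=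
  le_antisymm (Nat.find_min' (exists_prime_gt 0) ⟨by norm_num, Nat.prime_two⟩)
    (primeAbove_prime 0).two_le

/-- This makes `c ↦ g_c` injective on `c < q ^ (d + 1)`. -/
theorem mod_pow_eq_of_digits_eq {q c c' d : ℕ}
    (h : ∀ i < d, c / q ^ i % q = c' / q ^ i % q) : c % q ^ d = c' % q ^ d := by
  induction d with
  | zero => simp [Nat.mod_one]
  | succ d ih =>
    rw [Nat.mod_pow_succ, Nat.mod_pow_succ, ih fun i hi => h i (by omega), h d (by omega)]

open Polynomial in
/-- Two different polynomials of degree at most `d` over `GF(q)` agree on at most `d` points. -/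
theorem card_linialPoly_eq_le {q d c c' : ℕ} (hq : q.Prime) (hc : c < q ^ (d + 1))
    (hc' : c' < q ^ (d + 1)) (hne : c ≠ c') :
    ((Finset.range q).filter fun x => linialPoly q d c x = linialPoly q d c' x).card ≤ d := by
  have := Fact.mk hq
  let P : ℕ → (ZMod q)[X] := fun c =>
    ∑ i ∈ Finset.range (d + 1), C ((c / q ^ i % q : ℕ) : ZMod q) * X ^ i
  have hcoeff : ∀ c, ∀ i < d + 1, (P c).coeff i = ((c / q ^ i % q : ℕ) : ZMod q) := by
    intro c i hi
    simp only [P, finsetSum_coeff, coeff_C_mul_X_pow]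
    rw [Finset.sum_eq_single i]
    · simp
    · intro b _ hb; simp [Ne.symm hb]
    · intro h; exact absurd (Finset.mem_range.2 hi) h
  have hdeg : ∀ c, (P c).natDegree ≤ d := by
    intro c
    refine natDegree_sum_le_of_forall_le _ _ fun i hi => ?_
    exact (natDegree_C_mul_X_pow_le _ _).trans (by simpa [Nat.lt_succ_iff] using hi)
  have heval : ∀ c x : ℕ, (P c).eval (x : ZMod q) = (linialPoly q d c x : ZMod q) := by
    intro c x
    simp [P, linialPoly, eval_finsetSum]
  have hP : P c - P c' ≠ 0 := by
    intro h0
    apply hne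
    rw [← Nat.mod_eq_of_lt hc, ← Nat.mod_eq_of_lt hc']
    refine mod_pow_eq_of_digits_eq fun i hi => ?_
    have h1 : (P c).coeff i = (P c').coeff i := by rw [sub_eq_zero.1 h0]
    rw [hcoeff c i hi, hcoeff c' i hi, ZMod.natCast_eq_natCast_iff'] at h1
    simpa using h1
  refine le_trans ?_ ((card_roots' (P c - P c')).trans
    ((natDegree_sub_le _ _).trans (max_le (hdeg c) (hdeg c'))))
  refine le_trans ?_ (Multiset.toFinset_card_le _)
  -- Agreement points are roots of the nonzero difference, and casting to `ZMod q` is injective on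
  -- `{0, ..., q - 1}`.
  refine Finset.card_le_card_of_injOn (fun x : ℕ => (x : ZMod q)) ?_ ?_
  · intro x hx
    have hx2 := (Finset.mem_filter.1 hx).2
    simp [hP, heval, hx2]
  · intro x hx y hy hxy
    have hx1 := Finset.mem_range.1 (Finset.mem_filter.1 hx).1
    have hy1 := Finset.mem_range.1 (Finset.mem_filter.1 hy).1
    have := (ZMod.natCast_eq_natCast_iff' x y q).1 hxy
    rwa [Nat.mod_eq_of_lt hx1, Nat.mod_eq_of_lt hy1] at this

end SelfStab

/-! ### The function `log*` and the number of Linial iterations -/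

namespace SelfStab

theorem logb_two_le_sub_one {x : ℝ} (hx : 2 ≤ x) : Real.logb 2 x ≤ x - 1 := by
  rw [Real.logb_le_iff_le_rpow (by norm_num) (by linarith)]
  have h := one_add_mul_self_le_rpow_one_add (s := (1 : ℝ)) (p := x - 1) (by norm_num) (by linarith)
  norm_num at h
  linarith

/-- As long as the value is at least `2`, taking the logarithm lowers it by at least `1`. So the
infimum defining `logStar` is attained and is not the default value of an empty set. -/
theorem exists_iterate_logb_lt_two (x : ℝ) : ∃ k, (Real.logb 2)^[k] x < 2 := by
  by_contra! h
  have h1 : ∀ k : ℕ, (Real.logb 2)^[k] x ≤ x - k := by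
    intro k
    induction k with
    | zero => simp
    | succ k ih =>
      rw [Function.iterate_succ_apply']
      have := logb_two_le_sub_one (h k)
      push_cast
      linarith
  obtain ⟨k, hk⟩ := exists_nat_gt x
  linarith [h k, h1 k]

theorem iterate_logb_logStar_lt (x : ℝ) : (Real.logb 2)^[logStar x] x < 2 :=
  Nat.sInf_mem (s := {k : ℕ | (Real.logb 2)^[k] x < 2}) (exists_iterate_logb_lt_two x)

theorem two_le_iterate_logb {x : ℝ} {k : ℕ} (h : k < logStar x) : 2 ≤ (Real.logb 2)^[k] x :=
  not_lt.1 (Nat.notMem_of_lt_sInf (s := {k : ℕ | (Real.logb 2)^[k] x < 2}) h)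

/-- One iteration shrinks a palette of `m ≤ (D z)²` colors, where `D = 8 (Δ + 1)`, unless
it is already below the threshold `D³`. -/
theorem linialField_sq_le {Δ m : ℕ} {z : ℝ} (hz : 0 < z) (hm : (8 * (Δ + 1)) ^ 3 < m)
    (hmz : (m : ℝ) ≤ ((8 * (Δ + 1)) * z) ^ 2) :
    linialField Δ m ^ 2 ≤ (8 * (Δ + 1)) ^ 3 ∨
      ((linialField Δ m ^ 2 : ℕ) : ℝ) ≤
        ((8 * (Δ + 1)) * (1 / 4 + 3 / 2 * Real.logb 2 z)) ^ 2 := by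
  -- Bertrand's postulate needs a nonzero bound; in the degenerate case the field has size `2`.
  by_cases h0 : linialDegree m * Δ = 0
  · left
    unfold linialField
    rw [h0, primeAbove_zero]
    have : 8 ^ 3 ≤ (8 * (Δ + 1)) ^ 3 := Nat.pow_le_pow_left (by omega) 3
    omega
  right
  have hp : linialField Δ m ≤ 2 * (linialDegree m * Δ) := primeAbove_le_two_mul h0
  set D : ℝ := 8 * (Δ + 1) with hD
  have hΔ : (0 : ℝ) ≤ Δ := Nat.cast_nonneg _
  have hD8 : 8 ≤ D := by linarith
  have hmR : D ^ 3 < m := by rw [hD]; exact_mod_cast hm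
  have hm0 : (0 : ℝ) < m := lt_trans (by positivity) hmR
  -- Being above the threshold `D³` lets `D` be absorbed: `log m ≤ 2 (log D + log z) ≤ 6 log z`.
  have hDz : D ≤ z ^ 2 := by
    have : D ^ 3 < D ^ 2 * z ^ 2 := by rw [← mul_pow]; linarith
    have h2 : 0 < D ^ 2 := by positivity
    nlinarith
  have hlogD : Real.logb 2 D ≤ 2 * Real.logb 2 z := by
    have := Real.logb_le_logb_of_le (b := 2) (by norm_num) (by linarith) hDz
    rwa [Real.logb_pow] at this
  have hlogm : Real.logb 2 m ≤ 2 * (Real.logb 2 D + Real.logb 2 z) := by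
    have := Real.logb_le_logb_of_le (b := 2) (by norm_num) hm0 hmz
    rw [Real.logb_pow, Real.logb_mul (by linarith) hz.ne'] at this
    exact_mod_cast this
  have hd : (linialDegree m : ℝ) ≤ 1 + Real.logb 2 m := by
    have h1 : linialDegree m ≤ Nat.log 2 m + 1 := by
      refine Nat.clog_le_of_le_pow (Nat.lt_pow_succ_log_self (by norm_num) m).le
    have h2 := Real.natLog_le_logb m 2
    have h3 : (linialDegree m : ℝ) ≤ Nat.log 2 m + 1 := by exact_mod_cast h1
    push_cast at h2
    linarith
  have hfin : (linialField Δ m : ℝ) ≤ D * (1 / 4 + 3 / 2 * Real.logb 2 z) := by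
    have h1 : (linialField Δ m : ℝ) ≤ 2 * (linialDegree m * Δ) := by exact_mod_cast hp
    have h2 : (linialDegree m : ℝ) ≤ 1 + 6 * Real.logb 2 z := by linarith
    have h3 : (0 : ℝ) ≤ linialDegree m := Nat.cast_nonneg _
    have h4 : (linialDegree m : ℝ) * Δ ≤ (1 + 6 * Real.logb 2 z) * (D / 8) := by
      apply mul_le_mul h2 (by linarith) hΔ (by linarith)
    nlinarith
  push_cast
  exact pow_le_pow_left₀ (Nat.cast_nonneg _) hfin 2

/-- If palette sizes are written as `(D z)²` with `D = 8 (Δ + 1)`, an iteration acts on the bounds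
as `z ↦ 1/4 + 3/2 log₂ z`, in which `Δ` no longer occurs. -/
theorem palette_succ_le {n Δ i : ℕ} {z w : ℝ} (hz : 0 < z)
    (hi : (8 * (Δ + 1)) ^ 3 < palette n Δ i)
    (hi' : (8 * (Δ + 1)) ^ 3 < palette n Δ (i + 1))
    (h : (palette n Δ i : ℝ) ≤ ((8 * (Δ + 1)) * z) ^ 2)
    (hw : z ≤ w) {y : ℝ} (hy : 1 / 4 + 3 / 2 * Real.logb 2 w ≤ y) :
    0 < y ∧ (palette n Δ (i + 1) : ℝ) ≤ ((8 * (Δ + 1)) * y) ^ 2 := by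
  have hw0 : 0 < w := hz.trans_le hw
  have hΔ : (0 : ℝ) ≤ Δ := Nat.cast_nonneg _
  have h1 : (palette n Δ i : ℝ) ≤ ((8 * (Δ + 1)) * w) ^ 2 := by
    refine h.trans (pow_le_pow_left₀ (by positivity) ?_ 2)
    gcongr
  have hDw : 8 ≤ w ^ 2 := by
    have h2 : ((8 * (Δ + 1) : ℝ)) ^ 3 < palette n Δ i := by exact_mod_cast hi
    have h3 : ((8 * (Δ + 1) : ℝ)) ^ 3 < (8 * (Δ + 1)) ^ 2 * w ^ 2 := by rw [← mul_pow]; linarith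
    have h4 : (0 : ℝ) < (8 * (Δ + 1)) ^ 2 := by positivity
    nlinarith
  have hw1 : 1 ≤ w := by nlinarith
  have hlog : 0 ≤ Real.logb 2 w := Real.logb_nonneg (by norm_num) hw1
  refine ⟨by linarith, ?_⟩
  rcases linialField_sq_le hw0 hi h1 with h2 | h2
  · exact absurd h2 (not_le.2 hi')
  · refine h2.trans (pow_le_pow_left₀ (by positivity) ?_ 2)
    gcongr

/-- The factor `4` reproduces itself: with `y = log₂ x`, one has `1/4 + 3/2 (2 + y) ≤ 4 y` once `y ≥
2`, and this holds for the iterates before `log* n`. -/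
theorem palette_le_iterate_logb {n Δ i : ℕ} (hi : i < logStar (n : ℝ))
    (h : ∀ j ≤ i, (8 * (Δ + 1)) ^ 3 < palette n Δ j) :
    (palette n Δ i : ℝ) ≤ ((8 * (Δ + 1)) * (4 * (Real.logb 2)^[i] n)) ^ 2 := by
  induction i with
  | zero =>
    have h0 := two_le_iterate_logb hi
    simp only [Function.iterate_zero, id_eq, palette] at h0 ⊢
    have hΔ : (0 : ℝ) ≤ Δ := Nat.cast_nonneg _
    have h1 : (n : ℝ) ≤ (8 * (Δ + 1)) * (4 * n) := by nlinarith
    nlinarith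
  | succ i ih =>
    have h0 := two_le_iterate_logb (by omega : i < logStar (n : ℝ))
    have h1 := two_le_iterate_logb hi
    rw [Function.iterate_succ_apply'] at h1 ⊢
    set x := (Real.logb 2)^[i] (n : ℝ)
    refine (palette_succ_le (by linarith : (0 : ℝ) < 4 * x) (h i (by omega)) (h (i + 1) le_rfl)
      (ih (by omega) fun j hj => h j (by omega)) le_rfl ?_).2
    have h4 : Real.logb 2 4 = 2 := by
      rw [show (4 : ℝ) = 2 ^ (2 : ℝ) by norm_num, Real.logb_rpow] <;> norm_num
    rw [Real.logb_mul (by norm_num) (by linarith), h4]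
    linarith

/-- Reduces rational upper bounds on logarithms to comparing integer powers. -/
theorem logb_two_le_div {w : ℝ} (hw : 0 < w) {a b : ℕ} (hb : 0 < b) (h : w ^ b ≤ 2 ^ a) :
    Real.logb 2 w ≤ a / b := by
  have h1 := Real.logb_le_logb_of_le (b := 2) (by norm_num) (by positivity) h
  rw [Real.logb_pow, Real.logb_pow, Real.logb_self_eq_one (by norm_num)] at h1
  rw [le_div_iff₀ (by exact_mod_cast hb)]
  linarith

/-- The palette is below the threshold after `log* n + O(1)` iterations. -/
theorem exists_palette_le (n Δ : ℕ) :
    ∃ k ≤ logStar (n : ℝ) + 6, palette n Δ k ≤ (8 * (Δ + 1)) ^ 3 := by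
  by_contra! h
  set L := logStar (n : ℝ) with hL
  have hΔ : (0 : ℝ) ≤ Δ := Nat.cast_nonneg _
  -- The last iterate is below `2`, and `1/4 + 3/2 (2 + 2) = 25/4 ≤ 7`.
  have h7 : (palette n Δ L : ℝ) ≤ ((8 * (Δ + 1)) * 7) ^ 2 := by
    rcases Nat.eq_zero_or_pos L with h0 | h0
    · have h1 := iterate_logb_logStar_lt (n : ℝ)
      rw [← hL, h0, Function.iterate_zero, id_eq] at h1
      rw [h0, palette]
      nlinarith
    · obtain ⟨i, hi⟩ : ∃ i, L = i + 1 := ⟨L - 1, by omega⟩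
      have h1 := iterate_logb_logStar_lt (n : ℝ)
      have h2 := two_le_iterate_logb (by omega : i < logStar (n : ℝ))
      have h3 := palette_le_iterate_logb (Δ := Δ) (by omega : i < logStar (n : ℝ))
        fun j hj => h j (by omega)
      rw [← hL, hi, Function.iterate_succ_apply'] at h1
      rw [hi]
      refine (palette_succ_le (by linarith) (h i (by omega)) (h (i + 1) (by omega)) h3 le_rfl ?_).2
      have h4 : Real.logb 2 4 = 2 := by
        rw [show (4 : ℝ) = 2 ^ (2 : ℝ) by norm_num, Real.logb_rpow] <;> norm_num
      rw [Real.logb_mul (by norm_num) (by linarith), h4]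
      linarith
  have step : ∀ (i : ℕ) (z y : ℝ) (a b : ℕ), i < 6 → 0 < z → 0 < b → z ^ b ≤ 2 ^ a →
      1 / 4 + 3 / 2 * ((a : ℝ) / b) ≤ y →
      (palette n Δ (L + i) : ℝ) ≤ ((8 * (Δ + 1)) * z) ^ 2 →
      (palette n Δ (L + (i + 1)) : ℝ) ≤ ((8 * (Δ + 1)) * y) ^ 2 := by
    intro i z y a b hi hz hb hab hy hp
    refine (palette_succ_le hz (h _ (by omega)) (h (L + i + 1) (by omega)) hp le_rfl ?_).2
    have := logb_two_le_div hz hb hab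
    linarith
  -- Five more iterations take `z` through `7, 19/4, 4, 13/4, 23/8, 53/20`. The chain stops once `z²
  -- < 8 ≤ D`, since then `(D z)² < D³`.
  have e1 := step 0 7 (19 / 4) 3 1 (by norm_num) (by norm_num) (by norm_num) (by norm_num)
    (by norm_num) h7
  have e2 := step 1 (19 / 4) 4 5 2 (by norm_num) (by norm_num) (by norm_num) (by norm_num)
    (by norm_num) e1
  have e3 := step 2 4 (13 / 4) 2 1 (by norm_num) (by norm_num) (by norm_num) (by norm_num)
    (by norm_num) e2
  have e4 := step 3 (13 / 4) (23 / 8) 7 4 (by norm_num) (by norm_num) (by norm_num) (by norm_num)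
    (by norm_num) e3
  have e5 := step 4 (23 / 8) (53 / 20) 8 5 (by norm_num) (by norm_num) (by norm_num) (by norm_num)
    (by norm_num) e4
  have h2 : ((8 * (Δ + 1) : ℝ)) ^ 3 < palette n Δ (L + 5) := by exact_mod_cast h (L + 5) (by omega)
  have h3 : ((8 * (Δ + 1) : ℝ)) ^ 3 < (8 * (Δ + 1)) ^ 2 * (53 / 20) ^ 2 := by
    rw [← mul_pow]; linarith
  have h4 : (0 : ℝ) < (8 * (Δ + 1)) ^ 2 := by positivity
  nlinarith

theorem numIters_le (n Δ : ℕ) : numIters n Δ ≤ logStar (n : ℝ) + 7 := by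
  obtain ⟨k, hk, h⟩ := exists_palette_le n Δ
  have := Nat.sInf_le (s := {k : ℕ | palette n Δ k ≤ (8 * (Δ + 1)) ^ 3}) h
  unfold numIters
  omega

theorem palette_numIters_sub_one_le (n Δ : ℕ) :
    palette n Δ (numIters n Δ - 1) ≤ (8 * (Δ + 1)) ^ 3 := by
  obtain ⟨k, -, h⟩ := exists_palette_le n Δ
  exact Nat.sInf_mem (s := {k : ℕ | palette n Δ k ≤ (8 * (Δ + 1)) ^ 3}) ⟨k, h⟩

end SelfStab

/-! ### Arithmetic of the pairs `⟨a, b⟩` -/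

namespace SelfStab

theorem agField_prime (Δ : ℕ) : (agField Δ).Prime := primeAbove_prime _

theorem lt_agField (Δ : ℕ) : 8 * (Δ + 1) < agField Δ := lt_primeAbove _

theorem agField_le (Δ : ℕ) : agField Δ ≤ 16 * (Δ + 1) :=
  (primeAbove_le_two_mul (by omega)).trans (by omega)

theorem pairColor_div {q a b : ℕ} (hb : b < q) : pairColor q a b / q = a := by
  unfold pairColor
  rw [Nat.add_comm, Nat.add_mul_div_right _ _ (by omega), Nat.div_eq_of_lt hb, Nat.zero_add]

theorem pairColor_mod {q a b : ℕ} (hb : b < q) : pairColor q a b % q = b := by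
  unfold pairColor
  rw [Nat.add_comm, Nat.add_mul_mod_self_right, Nat.mod_eq_of_lt hb]

theorem agShift_div (Δ c : ℕ) : agShift Δ c / agField Δ = c / agField Δ :=
  pairColor_div (Nat.mod_lt _ (agField_pos Δ))

theorem agShift_mod (Δ c : ℕ) :
    agShift Δ c % agField Δ = (c / agField Δ + c % agField Δ) % agField Δ :=
  pairColor_mod (Nat.mod_lt _ (agField_pos Δ))

theorem agFinal_div (Δ c : ℕ) : agFinal Δ c / agField Δ = 0 :=
  pairColor_div (Nat.mod_lt _ (agField_pos Δ))

theorem agFinal_mod (Δ c : ℕ) : agFinal Δ c % agField Δ = c % agField Δ :=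
  pairColor_mod (Nat.mod_lt _ (agField_pos Δ))

theorem agFinal_lt (Δ c : ℕ) : agFinal Δ c < agField Δ ^ 2 :=
  pairColor_lt (agField_pos Δ) (Nat.mod_lt _ (agField_pos Δ))

theorem agShift_lt {Δ c : ℕ} (h : c < agField Δ ^ 2) : agShift Δ c < agField Δ ^ 2 :=
  pairColor_lt (Nat.div_lt_of_lt_mul (by rwa [← sq])) (Nat.mod_lt _ (agField_pos Δ))

theorem eq_of_div_mod_eq {q c c' : ℕ} (h1 : c / q = c' / q) (h2 : c % q = c' % q) : c = c' := by
  rw [← Nat.div_add_mod c q, ← Nat.div_add_mod c' q, h1, h2]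

/-! ### Intervals -/

theorem intervalStart_zero (n Δ : ℕ) : intervalStart n Δ 0 = 0 := by simp [intervalStart]

theorem intervalStart_succ (n Δ j : ℕ) :
    intervalStart n Δ (j + 1) = intervalStart n Δ j + intervalSize n Δ j :=
  Finset.sum_range_succ _ _

theorem intervalStart_one (n Δ : ℕ) : intervalStart n Δ 1 = agField Δ ^ 2 := by
  simp [intervalStart, intervalSize]

theorem numIters_pos (n Δ : ℕ) : 0 < numIters n Δ := Nat.succ_pos _

theorem intervalIndex_eq {n Δ c j : ℕ} (hj : j ≤ numIters n Δ) (h1 : intervalStart n Δ j ≤ c)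
    (h2 : c < intervalStart n Δ (j + 1)) : intervalIndex n Δ c = j := by
  refine Nat.findGreatest_eq_iff.2 ⟨hj, fun _ => h1, fun k hk _ h => ?_⟩
  have := intervalStart_mono n Δ (show j + 1 ≤ k from hk)
  omega

theorem intervalStart_intervalIndex_le (n Δ c : ℕ) :
    intervalStart n Δ (intervalIndex n Δ c) ≤ c :=
  Nat.findGreatest_spec (P := fun j => intervalStart n Δ j ≤ c) (Nat.zero_le _)
    (by simp [intervalStart_zero])

theorem lt_intervalStart_intervalIndex_succ {n Δ c : ℕ} (hc : c < numColors n Δ) :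
    c < intervalStart n Δ (intervalIndex n Δ c + 1) := by
  rcases (intervalIndex_le n Δ c).eq_or_lt with h | h
  · rw [h]; exact hc
  · exact not_le.1 (Nat.findGreatest_is_greatest (P := fun j => intervalStart n Δ j ≤ c)
      (Nat.lt_succ_self _) h)

theorem intervalIndex_eq_zero {n Δ c : ℕ} (hc : c < agField Δ ^ 2) : intervalIndex n Δ c = 0 :=
  intervalIndex_eq (Nat.zero_le _) (by simp [intervalStart_zero]) (by rwa [intervalStart_one])

theorem initialColor_lt (n Δ : ℕ) (id : Fin n) :
    initialColor n Δ id < intervalStart n Δ (numIters n Δ + 1) := by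
  have h0 : numIters n Δ ≠ 0 := (numIters_pos n Δ).ne'
  have := id.isLt
  rw [intervalStart_succ, intervalSize, if_neg h0, Nat.sub_self, palette, initialColor]
  omega

theorem intervalIndex_initialColor (n Δ : ℕ) (id : Fin n) :
    intervalIndex n Δ (initialColor n Δ id) = numIters n Δ :=
  intervalIndex_eq le_rfl (Nat.le_add_right _ _) (initialColor_lt n Δ id)

theorem levelField_prime (n Δ j : ℕ) : (levelField n Δ j).Prime := by
  unfold levelField
  split_ifs
  · exact agField_prime Δ
  · exact primeAbove_prime _

/-- Ensures that positions in `I_j` have at most `d + 1` digits, so that distinct colors get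
distinct polynomials. For `j = 1` this is where the threshold `(8 (Δ + 1))³` matches degree `2`. -/
theorem intervalSize_le_levelField_pow {n Δ j : ℕ} (hj : 1 ≤ j) :
    intervalSize n Δ j ≤ levelField n Δ j ^ (levelDegree n Δ j + 1) := by
  rcases hj.eq_or_lt with rfl | hj
  · simp only [intervalSize, levelField, levelDegree, one_ne_zero, if_false, if_true]
    exact (palette_numIters_sub_one_le n Δ).trans (Nat.pow_le_pow_left (lt_agField Δ).le 3)
  · have h2 := (levelField_prime n Δ j).two_le
    rw [levelDegree, if_neg (by omega)]
    refine (Nat.le_pow_clog one_lt_two _).trans ((Nat.pow_le_pow_left h2 _).trans ?_)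
    exact Nat.pow_le_pow_right (by omega) (Nat.le_succ _)

/-- The value at `x` of the polynomial of the color `c` of `I_j`. -/
noncomputable def levelPoly (n Δ j c x : ℕ) : ℕ :=
  linialPoly (levelField n Δ j) (levelDegree n Δ j) (c - intervalStart n Δ j) x

theorem levelPoly_lt (n Δ j c x : ℕ) : levelPoly n Δ j c x < levelField n Δ j :=
  Nat.mod_lt _ (levelField_prime n Δ j).pos

theorem card_levelPoly_eq_le {n Δ j c c' : ℕ} (hj : 1 ≤ j) (hc : c < numColors n Δ)
    (hc' : c' < numColors n Δ) (h : intervalIndex n Δ c = j) (h' : intervalIndex n Δ c' = j)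
    (hne : c ≠ c') :
    ((Finset.range (levelField n Δ j)).filter
      fun x => levelPoly n Δ j c x = levelPoly n Δ j c' x).card ≤ levelDegree n Δ j := by
  have hs := intervalSize_le_levelField_pow (n := n) (Δ := Δ) hj
  have h1 := intervalStart_intervalIndex_le n Δ c
  have h2 := lt_intervalStart_intervalIndex_succ hc
  have h1' := intervalStart_intervalIndex_le n Δ c'
  have h2' := lt_intervalStart_intervalIndex_succ hc'
  rw [h, intervalStart_succ] at h2
  rw [h', intervalStart_succ] at h2'
  rw [h] at h1
  rw [h'] at h1'
  exact card_linialPoly_eq_le (levelField_prime n Δ j) (by omega) (by omega) (by omega)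

/-- If there are few neighbors and few forbidden colors, then the search of Mod-Linial succeeds. -/
theorem exists_modLinial_eq {n Δ my j : ℕ} {Q R : Finset ℕ} (hj : 1 ≤ j)
    (hmy : my < numColors n Δ) (hi : intervalIndex n Δ my = j)
    (hQ : ∀ c ∈ Q, c < numColors n Δ ∧ intervalIndex n Δ c = j ∧ c ≠ my)
    (hcard : Q.card * levelDegree n Δ j + R.card < levelField n Δ j) :
    ∃ x < levelField n Δ j,
      modLinial n Δ my Q R =
        intervalStart n Δ (j - 1) + pairColor (levelField n Δ j) x (levelPoly n Δ j my x) ∧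
      (∀ c ∈ Q, levelPoly n Δ j my x ≠ levelPoly n Δ j c x) ∧ modLinial n Δ my Q R ∉ R := by
  set q := levelField n Δ j with hq
  let new : ℕ → ℕ := fun x => intervalStart n Δ (j - 1) + pairColor q x (levelPoly n Δ j my x)
  set A := {x : ℕ | x < q ∧ (∀ c ∈ Q, levelPoly n Δ j my x ≠ levelPoly n Δ j c x) ∧ new x ∉ R}
    with hA
  have hval : modLinial n Δ my Q R = new (sInf A) := by
    unfold modLinial
    rw [hi]
    rfl
  suffices hne : A.Nonempty by
    obtain ⟨h1, h2, h3⟩ := Nat.sInf_mem hne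
    exact ⟨sInf A, h1, hval, h2, hval ▸ h3⟩
  by_contra hA0
  -- Each neighbor color rules out at most `d` points, and each forbidden color at most one, as `x`
  -- can be read off the new color. If the search failed, these points would exhaust the field.
  let B := Q.biUnion fun c =>
    (Finset.range q).filter fun x => levelPoly n Δ j my x = levelPoly n Δ j c x
  let B' := (Finset.range q).filter fun x => new x ∈ R
  have hB : B.card ≤ Q.card * levelDegree n Δ j :=
    Finset.card_biUnion_le_card_mul _ _ _ fun c hc =>
      card_levelPoly_eq_le hj hmy (hQ c hc).1 hi (hQ c hc).2.1 (hQ c hc).2.2.symm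
  have hB' : B'.card ≤ R.card := by
    refine Finset.card_le_card_of_injOn new (fun x hx => (Finset.mem_filter.1 hx).2) ?_
    intro x _ y _ hxy
    have h1 : pairColor q x (levelPoly n Δ j my x) = pairColor q y (levelPoly n Δ j my y) :=
      Nat.add_left_cancel hxy
    rw [← pairColor_div (a := x) (levelPoly_lt n Δ j my x), ← hq, h1,
      pairColor_div (levelPoly_lt n Δ j my y)]
  have hsub : Finset.range q ⊆ B ∪ B' := by
    intro x hx
    by_contra hxB
    refine hA0 ⟨x, Finset.mem_range.1 hx, fun c hc h => hxB ?_, fun h => hxB ?_⟩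
    · exact Finset.mem_union_left _ (Finset.mem_biUnion.2 ⟨c, hc, Finset.mem_filter.2 ⟨hx, h⟩⟩)
    · exact Finset.mem_union_right _ (Finset.mem_filter.2 ⟨hx, h⟩)
  have := (Finset.card_le_card hsub).trans (Finset.card_union_le _ _)
  rw [Finset.card_range] at this
  omega

/-! ### One step of Self-Stabilizing-Coloring -/

theorem selfStabilizingColoring_of_mem {n Δ id my : ℕ} {nbrs : Finset ℕ} (h : my ∈ nbrs) :
    selfStabilizingColoring n Δ id my nbrs = initialColor n Δ id := by
  rw [selfStabilizingColoring, if_pos h]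

/-- The field is large enough for the search: `d |Q| ≤ d Δ < q` for `j ≥ 2`. For `j = 1` the
neighbors in `I_1` and in `I_0` are disjoint, each costing at most two points, so at most `2Δ < q`
points are lost. -/
theorem selfStabilizingColoring_of_pos {n Δ my : ℕ} (id : ℕ) {nbrs : Finset ℕ} (h : my ∉ nbrs)
    (hmy : my < numColors n Δ) (hn : ∀ c ∈ nbrs, c < numColors n Δ) (hcard : nbrs.card ≤ Δ)
    (hj : 1 ≤ intervalIndex n Δ my) :
    ∃ x < levelField n Δ (intervalIndex n Δ my),
      selfStabilizingColoring n Δ id my nbrs =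
        intervalStart n Δ (intervalIndex n Δ my - 1) +
          pairColor (levelField n Δ (intervalIndex n Δ my)) x
            (levelPoly n Δ (intervalIndex n Δ my) my x) ∧
      (∀ c ∈ nbrs, intervalIndex n Δ c = intervalIndex n Δ my →
        levelPoly n Δ (intervalIndex n Δ my) my x ≠ levelPoly n Δ (intervalIndex n Δ my) c x) ∧
      (intervalIndex n Δ my = 1 → ∀ c ∈ nbrs, intervalIndex n Δ c = 0 →
        selfStabilizingColoring n Δ id my nbrs ≠ agShift Δ c ∧
        selfStabilizingColoring n Δ id my nbrs ≠ agFinal Δ c) := by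
  set j := intervalIndex n Δ my with hjdef
  let Q := nbrs.filter fun c => intervalIndex n Δ c = j
  have hQ : ∀ c ∈ Q, c < numColors n Δ ∧ intervalIndex n Δ c = j ∧ c ≠ my := by
    intro c hc
    obtain ⟨h1, h2⟩ := Finset.mem_filter.1 hc
    exact ⟨hn c h1, h2, fun h3 => h (h3 ▸ h1)⟩
  have hQcard : Q.card ≤ Δ := (Finset.card_filter_le _ _).trans hcard
  rcases hj.eq_or_lt with hj1 | hj1
  · let S := nbrs.filter fun c => intervalIndex n Δ c = 0
    let R := S.image (agShift Δ) ∪ S.image (agFinal Δ)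
    have hval : selfStabilizingColoring n Δ id my nbrs = modLinial n Δ my Q R := by
      rw [selfStabilizingColoring, if_neg h]
      simp only [← hjdef, ← hj1]
      simp [Q, R, S, ← hj1]
    have hQS : Q.card + S.card ≤ Δ := by
      refine le_trans (le_of_eq ?_) (((Finset.card_filter_le nbrs
        fun c => intervalIndex n Δ c = j ∨ intervalIndex n Δ c = 0)).trans hcard)
      rw [Finset.filter_or, Finset.card_union_of_disjoint]
      exact Finset.disjoint_filter.2 fun c _ h1 h2 => by omega
    have hR : R.card ≤ 2 * S.card := by
      have := Finset.card_union_le (S.image (agShift Δ)) (S.image (agFinal Δ))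
      have h1 := Finset.card_image_le (s := S) (f := agShift Δ)
      have h2 := Finset.card_image_le (s := S) (f := agFinal Δ)
      change (S.image (agShift Δ) ∪ S.image (agFinal Δ)).card ≤ _
      omega
    have hlt := lt_agField Δ
    obtain ⟨x, hx, h1, h2, h3⟩ := exists_modLinial_eq (R := R) hj hmy hjdef.symm hQ (by
      rw [levelDegree, levelField, if_pos hj1.symm, if_pos hj1.symm]; omega)
    rw [hval]
    refine ⟨x, hx, h1, fun c hc hcj => h2 c (Finset.mem_filter.2 ⟨hc, hcj⟩), fun _ c hc hc0 => ?_⟩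
    have hcS : c ∈ S := Finset.mem_filter.2 ⟨hc, hc0⟩
    constructor
    · intro h4
      exact h3 (Finset.mem_union_left _ (h4 ▸ Finset.mem_image_of_mem _ hcS))
    · intro h4
      exact h3 (Finset.mem_union_right _ (h4 ▸ Finset.mem_image_of_mem _ hcS))
  · have hval : selfStabilizingColoring n Δ id my nbrs = modLinial n Δ my Q ∅ := by
      rw [selfStabilizingColoring, if_neg h]
      exact if_pos hj1
    obtain ⟨x, hx, h1, h2, h3⟩ := exists_modLinial_eq (R := ∅) hj hmy hjdef.symm hQ (by
      rw [levelDegree, levelField, if_neg (by omega), if_neg (by omega), Finset.card_empty]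
      refine lt_of_le_of_lt ?_ (lt_primeAbove _)
      rw [add_zero, mul_comm]
      exact Nat.mul_le_mul_left _ hQcard)
    rw [hval]
    exact ⟨x, hx, h1, fun c hc hcj => h2 c (Finset.mem_filter.2 ⟨hc, hcj⟩), fun h4 => by omega⟩

theorem selfStabilizingColoring_of_zero {n Δ my : ℕ} (id : ℕ) {nbrs : Finset ℕ} (h : my ∉ nbrs)
    (hj : intervalIndex n Δ my = 0) :
    ((∃ c ∈ nbrs, intervalIndex n Δ c = 0 ∧ c % agField Δ = my % agField Δ) ∧
      selfStabilizingColoring n Δ id my nbrs = agShift Δ my) ∨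
    (¬ (∃ c ∈ nbrs, intervalIndex n Δ c = 0 ∧ c % agField Δ = my % agField Δ) ∧
      selfStabilizingColoring n Δ id my nbrs = agFinal Δ my) := by
  rw [selfStabilizingColoring, if_neg h]
  simp only [hj, Finset.mem_filter, and_assoc]
  by_cases h1 : ∃ c ∈ nbrs, intervalIndex n Δ c = 0 ∧ c % agField Δ = my % agField Δ
  · left; exact ⟨h1, by simp [h1]⟩
  · right; exact ⟨h1, by simp [h1]⟩

/-- Truncated subtraction covers `I_0`, which is never left without a reset. -/
theorem intervalIndex_selfStabilizingColoring {n Δ my : ℕ} (id : ℕ) {nbrs : Finset ℕ}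
    (h : my ∉ nbrs)
    (hmy : my < numColors n Δ) (hn : ∀ c ∈ nbrs, c < numColors n Δ) (hcard : nbrs.card ≤ Δ) :
    intervalIndex n Δ (selfStabilizingColoring n Δ id my nbrs) = intervalIndex n Δ my - 1 := by
  rcases Nat.eq_zero_or_pos (intervalIndex n Δ my) with h0 | h0
  · have hlt := lt_of_intervalIndex_eq_zero n Δ my h0
    rw [h0]
    rcases selfStabilizingColoring_of_zero id h h0 with ⟨-, h1⟩ | ⟨-, h1⟩ <;> rw [h1]
    · exact intervalIndex_eq_zero (agShift_lt hlt)
    · exact intervalIndex_eq_zero (agFinal_lt Δ my)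
  · obtain ⟨x, hx, h1, -⟩ := selfStabilizingColoring_of_pos id h hmy hn hcard h0
    have hle := intervalIndex_le n Δ my
    rw [h1]
    refine intervalIndex_eq (by omega) (Nat.le_add_right _ _) ?_
    rw [intervalStart_succ, intervalSize_pred n Δ _ h0 hle]
    exact Nat.add_lt_add_left (pairColor_lt hx (levelPoly_lt _ _ _ _ _)) _

/-- After one step, adjacent vertices have different colors, whatever the colors were before. -/
theorem selfStabilizingColoring_ne {n Δ : ℕ} {u v : Fin n} {a b : ℕ} {A B : Finset ℕ}
    (huv : u ≠ v) (ha : a < numColors n Δ) (hb : b < numColors n Δ)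
    (hA : ∀ c ∈ A, c < numColors n Δ) (hB : ∀ c ∈ B, c < numColors n Δ)
    (hcA : A.card ≤ Δ) (hcB : B.card ≤ Δ) (hbA : b ∈ A) (haB : a ∈ B) :
    selfStabilizingColoring n Δ u a A ≠ selfStabilizingColoring n Δ v b B := by
  wlog hle : intervalIndex n Δ a ≤ intervalIndex n Δ b generalizing u v a b A B
  · exact (this huv.symm hb ha hB hA hcB hcA haB hbA (by omega)).symm
  intro heq
  have hr := numIters_pos n Δ
  have hra := intervalIndex_le n Δ a
  have hrb := intervalIndex_le n Δ b
  have hidx := congrArg (intervalIndex n Δ) heq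
  by_cases h1 : a ∈ A <;> by_cases h2 : b ∈ B
  -- Two resets differ by ID. A single reset lands in `I_r`, while the other vertex ends strictly
  -- below because `r ≥ 1`.
  · rw [selfStabilizingColoring_of_mem h1, selfStabilizingColoring_of_mem h2] at heq
    exact huv (Fin.ext (Nat.add_left_cancel heq))
  · rw [selfStabilizingColoring_of_mem h1, intervalIndex_initialColor,
      intervalIndex_selfStabilizingColoring _ h2 hb hB hcB] at hidx
    omega
  · rw [selfStabilizingColoring_of_mem h2, intervalIndex_initialColor,
      intervalIndex_selfStabilizingColoring _ h1 ha hA hcA] at hidx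
    omega
  · rw [intervalIndex_selfStabilizingColoring _ h1 ha hA hcA,
      intervalIndex_selfStabilizingColoring _ h2 hb hB hcB] at hidx
    rcases Nat.eq_zero_or_pos (intervalIndex n Δ a) with ha0 | ha0
    · rcases Nat.eq_zero_or_pos (intervalIndex n Δ b) with hb0 | hb0
      · have hab : a ≠ b := fun h => h1 (h ▸ hbA)
        have hdiv := congrArg (· / agField Δ) heq
        have hmod := congrArg (· % agField Δ) heq
        have hla := lt_of_intervalIndex_eq_zero n Δ a ha0
        rcases selfStabilizingColoring_of_zero u h1 ha0 with ⟨-, e1⟩ | ⟨n1, e1⟩ <;>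
        rcases selfStabilizingColoring_of_zero v h2 hb0 with ⟨-, e2⟩ | ⟨n2, e2⟩ <;>
        simp only [e1, e2, agShift_div, agShift_mod, agFinal_div, agFinal_mod] at hdiv hmod
        -- Two shifts preserve distinctness. If at least one vertex finalizes, equal new colors mean
        -- equal old second coordinates (a shift with `a = 0` changes nothing), so the finalizing
        -- vertex had a conflict.
        · refine hab (eq_of_div_mod_eq hdiv ?_)
          rw [hdiv] at hmod
          have := Nat.ModEq.add_left_cancel' _ hmod
          simpa [Nat.ModEq] using this
        · refine n2 ⟨a, haB, ha0, ?_⟩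
          rw [← hmod, hdiv, Nat.zero_add, Nat.mod_mod]
        · refine n1 ⟨b, hbA, hb0, ?_⟩
          rw [hmod, ← hdiv, Nat.zero_add, Nat.mod_mod]
        · exact n2 ⟨a, haB, ha0, hmod⟩
      · obtain ⟨x, hx, e1, -, e2⟩ := selfStabilizingColoring_of_pos v h2 hb hB hcB hb0
        obtain ⟨f1, f2⟩ := e2 (by omega) a haB ha0
        rcases selfStabilizingColoring_of_zero u h1 ha0 with ⟨-, g⟩ | ⟨-, g⟩
        · exact f1 (heq.symm.trans g)
        · exact f2 (heq.symm.trans g)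
    · have hab : intervalIndex n Δ a = intervalIndex n Δ b := by omega
      obtain ⟨x, hx, e1, e2, -⟩ := selfStabilizingColoring_of_pos u h1 ha hA hcA ha0
      obtain ⟨y, hy, f1, -⟩ := selfStabilizingColoring_of_pos v h2 hb hB hcB (by omega)
      rw [e1, f1, ← hab] at heq
      have heq := Nat.add_left_cancel heq
      have hdiv := congrArg (· / levelField n Δ (intervalIndex n Δ a)) heq
      have hmod := congrArg (· % levelField n Δ (intervalIndex n Δ a)) heq
      simp only [pairColor_div (levelPoly_lt _ _ _ _ _),
        pairColor_mod (levelPoly_lt _ _ _ _ _)] at hdiv hmod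
      subst hdiv
      exact e2 b hbA hab.symm hmod

end SelfStab

namespace SelfStab

/-! ### The Additive-Group phase -/

/-- Both possible steps inside `I_0`. -/
def AGSequence (Δ : ℕ) (f : ℕ → ℕ) : Prop :=
  ∀ t, f (t + 1) = agShift Δ (f t) ∨ f (t + 1) = agFinal Δ (f t)

theorem AGSequence.eq_of_div_eq_zero {Δ : ℕ} {f : ℕ → ℕ} (h : AGSequence Δ f) {t : ℕ}
    (h0 : f t / agField Δ = 0) (k : ℕ) : f (t + k) = f t := by
  induction k with
  | zero => rfl
  | succ k ih =>
    rw [← ih] at h0 ⊢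
    rcases h (t + k) with h1 | h1 <;> rw [← add_assoc, h1] <;>
      refine eq_of_div_mod_eq (q := agField Δ) ?_ ?_
    · rw [agShift_div]
    · rw [agShift_mod, h0, zero_add, Nat.mod_mod]
    · rw [agFinal_div, h0]
    · rw [agFinal_mod]

theorem AGSequence.div_eq {Δ : ℕ} {f : ℕ → ℕ} (h : AGSequence Δ f) (t : ℕ) :
    f t / agField Δ = 0 ∨ f t / agField Δ = f 0 / agField Δ := by
  induction t with
  | zero => right; rfl
  | succ t ih =>
    rcases h t with h1 | h1 <;> rw [h1]
    · rwa [agShift_div]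
    · left; exact agFinal_div Δ _

/-- Finalizing would make the first coordinate `0` forever, so an unchanged nonzero first coordinate
means that all `k` steps were shifts. -/
theorem AGSequence.mod_eq {Δ : ℕ} {f : ℕ → ℕ} (h : AGSequence Δ f) (t k : ℕ)
    (hk : f (t + k) / agField Δ = f t / agField Δ) :
    f (t + k) ≡ f t + k * (f t / agField Δ) [MOD agField Δ] := by
  by_cases h0 : f t / agField Δ = 0
  · rw [h.eq_of_div_eq_zero h0 k, h0, mul_zero, add_zero]
  · induction k with
    | zero => simp [Nat.ModEq]
    | succ k ih =>
      rw [← add_assoc] at hk ⊢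
      rcases h (t + k) with h1 | h1 <;> rw [h1] at hk ⊢
      · rw [agShift_div] at hk
        have h2 : agShift Δ (f (t + k)) ≡ f t / agField Δ + f (t + k) [MOD agField Δ] := by
          rw [Nat.ModEq, agShift_mod, hk, Nat.add_mod_mod]
        refine h2.trans (((ih hk).add_left _).trans ?_)
        rw [show f t / agField Δ + (f t + k * (f t / agField Δ)) =
          f t + (k + 1) * (f t / agField Δ) by ring]
      · exact absurd (hk.symm.trans (agFinal_div Δ _)) h0

/-- Two sequences that collide in the second coordinate twice within `q` rounds, with the same
first coordinates, are equal at these times. -/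
theorem AGSequence.eq_of_collisions {Δ : ℕ} {f g : ℕ → ℕ} (hf : AGSequence Δ f)
    (hg : AGSequence Δ g) {t k : ℕ} (hk : 0 < k) (hkq : k < agField Δ)
    (hft : f t < agField Δ ^ 2) (hgt : g t < agField Δ ^ 2)
    (hfk : f (t + k) / agField Δ = f t / agField Δ)
    (hgk : g (t + k) / agField Δ = g t / agField Δ)
    (h1 : f t ≡ g t [MOD agField Δ]) (h2 : f (t + k) ≡ g (t + k) [MOD agField Δ]) :
    f t = g t := by
  refine eq_of_div_mod_eq ?_ h1
  have h3 := ((hf.mod_eq t k hfk).symm.trans h2).trans (hg.mod_eq t k hgk)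
  have h4 : k * (f t / agField Δ) ≡ k * (g t / agField Δ) [MOD agField Δ] :=
    Nat.ModEq.add_left_cancel h1 h3
  -- `k` is invertible modulo the prime `q`, so the first coordinates agree as well.
  have hcop : Nat.gcd (agField Δ) k = 1 :=
    ((agField_prime Δ).coprime_iff_not_dvd).2 (Nat.not_dvd_of_pos_of_lt hk hkq)
  have h5 := Nat.ModEq.cancel_left_of_coprime hcop h4
  exact h5.eq_of_lt_of_lt (Nat.div_lt_of_lt_mul (by rwa [← sq]))
    (Nat.div_lt_of_lt_mul (by rwa [← sq]))

/-- After `2 Δ + 1` rounds in `I_0` all colors are of the form `⟨0, b⟩`. -/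
theorem div_agField_eq_zero_of_proper {V : Type*} [Finite V] {Δ : ℕ} {H : SimpleGraph V}
    {c : ℕ → V → ℕ} (v : V) (hdeg : (H.neighborSet v).ncard ≤ Δ)
    (hlt : ∀ t u, u = v ∨ H.Adj v u → c t u < agField Δ ^ 2)
    (hseq : ∀ u, u = v ∨ H.Adj v u → AGSequence Δ fun t => c t u)
    (hproper : ∀ t u, H.Adj v u → c t v ≠ c t u)
    (hfinal : ∀ t, (∀ u, H.Adj v u → c t u % agField Δ ≠ c t v % agField Δ) →
      c (t + 1) v = agFinal Δ (c t v)) :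
    c (2 * Δ + 1) v / agField Δ = 0 := by
  classical
  have := Fintype.ofFinite V
  by_contra hne
  have hv := hseq v (Or.inl rfl)
  have hnz : ∀ t ≤ 2 * Δ + 1, c t v / agField Δ ≠ 0 := by
    intro t ht h0
    obtain ⟨k, hk⟩ := Nat.exists_eq_add_of_le ht
    have h1 := hv.eq_of_div_eq_zero h0 k
    simp only [← hk] at h1
    exact hne (h1 ▸ h0)
  have hdiv : ∀ t ≤ 2 * Δ + 1, c t v / agField Δ = c 0 v / agField Δ := fun t ht =>
    (hv.div_eq t).resolve_left (hnz t ht)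
  have hex : ∀ t, ∃ u, t < 2 * Δ + 1 → H.Adj v u ∧ c t u % agField Δ = c t v % agField Δ := by
    intro t
    by_cases ht : t < 2 * Δ + 1
    · by_contra! h
      refine hnz (t + 1) ht ?_
      rw [hfinal t fun u hu => (h u).2 hu, agFinal_div]
    · exact ⟨v, fun h => absurd h ht⟩
  choose w hw using hex
  let N : Finset V := Finset.univ.filter fun u => H.Adj v u
  have hN : N.card ≤ Δ := by
    refine le_trans (le_of_eq ?_) hdeg
    rw [← Set.ncard_coe_finset]
    congr 1
    ext u
    simp [N]
  -- Pigeonhole: `2Δ + 1` rounds with a conflict, but only `2Δ` pairs of a neighbor and the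
  -- information whether its first coordinate is `0`. Within one such class the neighbor's first
  -- coordinate is the same at both times.
  obtain ⟨i, hi, j, hj, hij, heq⟩ := Finset.exists_ne_map_eq_of_card_lt_of_maps_to
    (s := Finset.range (2 * Δ + 1)) (t := N ×ˢ (Finset.univ : Finset Bool))
    (f := fun t => (w t, decide (c t (w t) / agField Δ = 0)))
    (by rw [Finset.card_product, Finset.card_range, Finset.card_univ, Fintype.card_bool]; omega)
    (fun t ht => by
      have := (hw t (Finset.mem_range.1 ht)).1
      exact Finset.mem_product.2
        ⟨Finset.mem_filter.2 ⟨Finset.mem_univ _, this⟩, Finset.mem_univ _⟩)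
  wlog hlt' : i < j generalizing i j
  · exact this j hj i hi hij.symm heq.symm (by omega)
  rw [Finset.mem_range] at hi hj
  obtain ⟨e1, e2⟩ := Prod.mk.inj heq
  obtain ⟨a1, m1⟩ := hw i hi
  obtain ⟨a2, m2⟩ := hw j hj
  rw [decide_eq_decide] at e2
  rw [← e1] at e2 m2
  obtain ⟨k, rfl⟩ := Nat.exists_eq_add_of_le hlt'.le
  have hu := hseq (w i) (Or.inr a1)
  have hq := lt_agField Δ
  refine hproper i (w i) a1 (hv.eq_of_collisions hu (k := k) (by omega) (by omega)
    (hlt i v (Or.inl rfl)) (hlt i (w i) (Or.inr a1)) ?_ ?_ m1.symm m2.symm)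
  · exact (hdiv _ hj.le).trans (hdiv _ hi.le).symm
  · by_cases h0 : c i (w i) / agField Δ = 0
    · exact (e2.1 h0).trans h0.symm
    · exact ((hu.div_eq (i + k)).resolve_left fun h => h0 (e2.2 h)).trans
        ((hu.div_eq i).resolve_left h0).symm

end SelfStab

namespace SelfStab

/-! ### Executions without faults -/

open Classical in
/-- The colors of the neighbors of `v`. -/
noncomputable def neighborColors {n Δ : ℕ} (N : Network n Δ) (s : Fin n → RAM n Δ) (v : Fin n) :
    Finset ℕ :=
  (Finset.univ.filter fun u => N.graph.Adj v u).image fun u => (s u).color.val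

theorem image_fst_received {n Δ : ℕ} (N : Network n Δ) (s : Fin n → RAM n Δ) (v : Fin n) :
    (received N s v).image Prod.fst = neighborColors N s v := by
  rw [received, neighborColors, Finset.image_image]
  rfl

theorem mem_neighborColors {n Δ : ℕ} {N : Network n Δ} {s : Fin n → RAM n Δ} {v : Fin n} {c : ℕ} :
    c ∈ neighborColors N s v ↔ ∃ u, N.graph.Adj v u ∧ (s u).color.val = c := by
  simp [neighborColors]

theorem mem_received {n Δ : ℕ} {N : Network n Δ} {s : Fin n → RAM n Δ} {v : Fin n}
    {m : ℕ × Bool} :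
    m ∈ received N s v ↔ ∃ u, N.graph.Adj v u ∧ ((s u).color.val, (s u).mu) = m := by
  simp [received]

theorem card_neighborColors_le {n Δ : ℕ} (N : Network n Δ) (s : Fin n → RAM n Δ) (v : Fin n) :
    (neighborColors N s v).card ≤ Δ := by
  classical
  refine Finset.card_image_le.trans (le_trans (le_of_eq ?_) (N.degree_le v))
  rw [← Set.ncard_coe_finset]
  congr 1
  ext u
  simp

theorem lt_numColors_of_mem_neighborColors {n Δ : ℕ} {N : Network n Δ} {s : Fin n → RAM n Δ}
    {v : Fin n} : ∀ c ∈ neighborColors N s v, c < numColors n Δ := by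
  intro c hc
  obtain ⟨u, -, rfl⟩ := mem_neighborColors.1 hc
  exact (s u).color.isLt

/-- An execution without faults in the fixed network `N`. -/
def Execution {n Δ : ℕ} (N : Network n Δ) (s : ℕ → Fin n → RAM n Δ) : Prop :=
  ∀ t, ∀ v ∈ N.verts, s (t + 1) v = misRound v (s t v) (received N (s t) v)

namespace Execution

variable {n Δ : ℕ} {N : Network n Δ} {s : ℕ → Fin n → RAM n Δ}

theorem shift (h : Execution N s) (k : ℕ) : Execution N fun t => s (k + t) := fun t => h (k + t)

theorem color_succ (h : Execution N s) (t : ℕ) {v : Fin n} (hv : v ∈ N.verts) :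
    (s (t + 1) v).color.val =
      selfStabilizingColoring n Δ v (s t v).color (neighborColors N (s t) v) := by
  rw [h t v hv, ← image_fst_received]
  rfl

theorem color_succ_ne (h : Execution N s) (t : ℕ) {u v : Fin n} (huv : N.graph.Adj u v) :
    (s (t + 1) u).color.val ≠ (s (t + 1) v).color.val := by
  rw [h.color_succ t (N.mem_verts_of_adj u v huv), h.color_succ t (N.mem_verts_of_adj v u huv.symm)]
  exact selfStabilizingColoring_ne huv.ne (s t u).color.isLt (s t v).color.isLt
    lt_numColors_of_mem_neighborColors lt_numColors_of_mem_neighborColors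
    (card_neighborColors_le _ _ _) (card_neighborColors_le _ _ _)
    (mem_neighborColors.2 ⟨v, huv, rfl⟩) (mem_neighborColors.2 ⟨u, huv.symm, rfl⟩)

theorem color_notMem (h : Execution N s) (t : ℕ) (v : Fin n) :
    (s (t + 1) v).color.val ∉ neighborColors N (s (t + 1)) v := by
  intro hmem
  obtain ⟨u, hu, he⟩ := mem_neighborColors.1 hmem
  exact h.color_succ_ne t hu he.symm

/-- The first round may reset vertices to `I_r`, so the descent is counted only from time `1`. -/
theorem intervalIndex_le_sub (h : Execution N s) {v : Fin n} (hv : v ∈ N.verts) (t : ℕ) :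
    intervalIndex n Δ (s (t + 1) v).color ≤ numIters n Δ - t := by
  induction t with
  | zero => exact intervalIndex_le n Δ _
  | succ t ih =>
    rw [h.color_succ (t + 1) hv, intervalIndex_selfStabilizingColoring _ (h.color_notMem t v)
      (s (t + 1) v).color.isLt lt_numColors_of_mem_neighborColors (card_neighborColors_le _ _ _)]
    omega

theorem color_lt_sq (h : Execution N s) {v : Fin n} (hv : v ∈ N.verts) {t : ℕ}
    (ht : numIters n Δ + 1 ≤ t) : (s t v).color.val < agField Δ ^ 2 := by
  obtain ⟨k, rfl⟩ := Nat.exists_eq_add_of_le ht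
  have h1 := h.intervalIndex_le_sub hv (numIters n Δ + k)
  rw [show numIters n Δ + k + 1 = numIters n Δ + 1 + k by omega] at h1
  exact lt_of_intervalIndex_eq_zero n Δ _ (by omega)

/-- In an execution whose colors are proper and in `I_0` the colors are final after `2 Δ + 1`
rounds. -/
theorem color_stable_of_lt_sq (h : Execution N s)
    (hproper : ∀ t u v, N.graph.Adj u v → (s t u).color.val ≠ (s t v).color.val)
    (hlt : ∀ t, ∀ v ∈ N.verts, (s t v).color.val < agField Δ ^ 2) {v : Fin n} (hv : v ∈ N.verts) :
    (s (2 * Δ + 1) v).color.val < agField Δ ∧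
      ∀ k, (s (2 * Δ + 1 + k) v).color.val = (s (2 * Δ + 1) v).color.val := by
  have hnot : ∀ t v, (s t v).color.val ∉ neighborColors N (s t) v := by
    intro t v hmem
    obtain ⟨u, hu, he⟩ := mem_neighborColors.1 hmem
    exact hproper t v u hu he.symm
  have hverts : ∀ u, u = v ∨ N.graph.Adj v u → u ∈ N.verts := by
    rintro u (rfl | hu)
    · exact hv
    · exact N.mem_verts_of_adj u v hu.symm
  have hstep : ∀ t, ∀ u ∈ N.verts, _ := fun t u hu =>
    selfStabilizingColoring_of_zero (n := n) (u : ℕ) (hnot t u)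
      (intervalIndex_eq_zero (hlt t u hu))
  have hseq : ∀ u ∈ N.verts, AGSequence Δ fun t => (s t u).color.val := by
    intro u hu t
    simp only [h.color_succ t hu]
    exact (hstep t u hu).imp And.right And.right
  have h0 : (s (2 * Δ + 1) v).color.val / agField Δ = 0 := by
    refine div_agField_eq_zero_of_proper (H := N.graph) (c := fun t u => (s t u).color.val) v
      (N.degree_le v) (fun t u hu => hlt t u (hverts u hu)) (fun u hu => hseq u (hverts u hu))
      (fun t u hu => hproper t v u hu) fun t ht => ?_
    simp only [h.color_succ t hv]
    refine ((hstep t v hv).resolve_left ?_).2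
    rintro ⟨⟨c, hc, -, hc2⟩, -⟩
    obtain ⟨u, hu, rfl⟩ := mem_neighborColors.1 hc
    exact ht u hu hc2
  refine ⟨?_, fun k => (hseq v hv).eq_of_div_eq_zero h0 k⟩
  exact (Nat.div_eq_zero_iff.1 h0).resolve_left (agField_pos Δ).ne'

/-- The coloring stabilizes, to a proper coloring with `O(Δ)` colors. -/
theorem color_stable (h : Execution N s) {t₁ : ℕ} (ht₁ : t₁ = numIters n Δ + 1 + (2 * Δ + 1)) :
    ∀ v ∈ N.verts, (s t₁ v).color.val < agField Δ ∧
      ∀ t, t₁ ≤ t → (s t v).color.val = (s t₁ v).color.val := by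
  subst ht₁
  intro v hv
  obtain ⟨h1, h2⟩ := (h.shift (numIters n Δ + 1)).color_stable_of_lt_sq
    (fun t u v huv => by
      have := h.color_succ_ne (numIters n Δ + t) huv
      rwa [show numIters n Δ + t + 1 = numIters n Δ + 1 + t by omega] at this)
    (fun t v hv => h.color_lt_sq hv (by omega)) hv
  refine ⟨h1, fun t ht => ?_⟩
  obtain ⟨k, rfl⟩ := Nat.exists_eq_add_of_le ht
  rw [add_assoc]
  exact h2 k

/-! ### Stabilization of the bits `μ` -/

theorem mu_succ (h : Execution N s) (t : ℕ) {v : Fin n} (hv : v ∈ N.verts) :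
    (s (t + 1) v).mu = true ↔ ∀ u, N.graph.Adj v u →
      (s t u).color.val < (s (t + 1) v).color.val → (s t u).mu = false := by
  rw [h.color_succ t hv, h t v hv, ← image_fst_received]
  simp only [misRound, decide_eq_true_eq]
  constructor
  · intro h1 u hu
    exact h1 _ (mem_received.2 ⟨u, hu, rfl⟩)
  · intro h1 m hm
    obtain ⟨u, hu, rfl⟩ := mem_received.1 hm
    exact h1 u hu

/-- Once the coloring is stable, the vertices of the first `k` colors have stable bits after `k`
rounds. -/
theorem mu_stable_of_color_lt (h : Execution N s) {t₁ : ℕ}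
    (hc : ∀ v ∈ N.verts, ∀ t, t₁ ≤ t → (s t v).color.val = (s t₁ v).color.val) (k : ℕ) :
    ∀ v ∈ N.verts, (s t₁ v).color.val < k → ∀ t, t₁ + k ≤ t → (s (t + 1) v).mu = (s t v).mu := by
  induction k with
  | zero => intro v _ hk; omega
  | succ k ih =>
    intro v hv hk t ht
    obtain ⟨t, rfl⟩ : ∃ t', t = t' + 1 := ⟨t - 1, by omega⟩
    rw [Bool.eq_iff_iff, h.mu_succ (t + 1) hv, h.mu_succ t hv, hc v hv (t + 1) (by omega),
      hc v hv (t + 1 + 1) (by omega)]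
    -- The bit depends only on neighbors of smaller color, whose bits are already constant one round
    -- earlier.
    refine forall_congr' fun u => forall_congr' fun hu => ?_
    have hu' := N.mem_verts_of_adj u v hu.symm
    rw [hc u hu' (t + 1) (by omega), hc u hu' t (by omega)]
    refine forall_congr' fun hlt => ?_
    rw [ih u hu' (by omega) t (by omega)]

theorem isMIS_misOutput (h : Execution N s) {t : ℕ}
    (hproper : ∀ u v, N.graph.Adj u v → (s t u).color.val ≠ (s t v).color.val)
    (hc : ∀ v ∈ N.verts, (s (t + 1) v).color.val = (s t v).color.val)
    (hmu : ∀ v ∈ N.verts, (s (t + 1) v).mu = (s t v).mu) : IsMIS N (misOutput N (s t)) := by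
  have hiff : ∀ v ∈ N.verts, ((s t v).mu = true ↔ ∀ u, N.graph.Adj v u →
      (s t u).color.val < (s t v).color.val → (s t u).mu = false) := by
    intro v hv
    rw [← hmu v hv, ← hc v hv]
    exact h.mu_succ t hv
  refine ⟨fun v hv => hv.1, ?_, ?_⟩
  · rintro u ⟨hu, hu1⟩ v ⟨hv, hv1⟩ huv
    -- Properness is needed only for independence: of two adjacent members, the one of larger color
    -- would have bit `0`.
    rcases (hproper u v huv).lt_or_gt with hlt | hlt
    · have := (hiff v hv).1 hv1 u huv.symm hlt
      simp [hu1] at this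
    · have := (hiff u hu).1 hu1 v huv hlt
      simp [hv1] at this
  · intro v hv hvU
    have h1 : ¬ (s t v).mu = true := fun h1 => hvU ⟨hv, h1⟩
    rw [hiff v hv] at h1
    push Not at h1
    obtain ⟨u, hu, -, hmu1⟩ := h1
    exact ⟨u, ⟨N.mem_verts_of_adj u v hu.symm, by simpa using hmu1⟩, hu⟩

/-- The algorithm stabilizes to a maximal independent set. -/
theorem exists_isMIS (h : Execution N s) :
    ∃ U, IsMIS N U ∧ ∀ t, numIters n Δ + 1 + (2 * Δ + 1) + agField Δ ≤ t →
      misOutput N (s t) = U := by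
  have hcol := h.color_stable rfl
  set t₁ := numIters n Δ + 1 + (2 * Δ + 1) with ht₁
  have hc := fun v hv => (hcol v hv).2
  have hmu : ∀ v ∈ N.verts, ∀ t, t₁ + agField Δ ≤ t → (s (t + 1) v).mu = (s t v).mu :=
    fun v hv => h.mu_stable_of_color_lt hc _ v hv (hcol v hv).1
  refine ⟨misOutput N (s (t₁ + agField Δ)), h.isMIS_misOutput (fun u v huv => ?_)
    (fun v hv => ?_) fun v hv => hmu v hv _ le_rfl, fun t ht => ?_⟩
  · exact h.color_succ_ne (numIters n Δ + (2 * Δ + 1) + agField Δ) huv |>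
      fun h' => by rwa [show numIters n Δ + (2 * Δ + 1) + agField Δ + 1 = t₁ + agField Δ by omega]
        at h'
  · rw [hc v hv _ (by omega), hc v hv (t₁ + agField Δ) (by omega)]
  · induction t, ht using Nat.le_induction with
    | base => rfl
    | succ t ht ih =>
      rw [← ih]
      ext v
      exact and_congr_right fun hv => by rw [hmu v hv t ht]

end Execution

end SelfStab

theorem mainTheorem4 :
    ∃ C : ℕ, ∀ (n Δ : ℕ) (G : ℕ → SelfStab.Network n Δ)
      (s : ℕ → Fin n → SelfStab.RAM n Δ) (T : ℕ),
      (∀ t, T ≤ t → SelfStab.FaultFree G s t) →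
      ∃ U : Set (Fin n), SelfStab.IsMIS (G T) U ∧
        ∀ t, T + C * (Δ + SelfStab.logStar (n : ℝ) + 1) ≤ t →
          SelfStab.misOutput (G t) (s t) = U := by
  -- The total is `r + 1 + (2Δ + 1) + q` with `r ≤ log* n + 7` and `q ≤ 16 (Δ + 1)`, hence at most
  -- `18Δ + log* n + 25`.
  refine ⟨25, fun n Δ G s T h => ?_⟩
  have hG : ∀ t, T ≤ t → G t = G T := by
    intro t ht
    induction t, ht using Nat.le_induction with
    | base => rfl
    | succ t ht ih => rw [(h t ht).1, ih]
  have hex : SelfStab.Execution (G T) fun t => s (T + t) := by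
    intro t v hv
    have h1 := (h (T + t) (by omega)).2 v
    rw [hG (T + t) (by omega)] at h1
    exact h1 hv
  obtain ⟨U, hU, hstable⟩ := hex.exists_isMIS
  refine ⟨U, hU, fun t ht => ?_⟩
  have h1 := SelfStab.numIters_le n Δ
  have h2 := SelfStab.agField_le Δ
  obtain ⟨k, rfl⟩ := Nat.exists_eq_add_of_le (show T ≤ t by omega)
  rw [hG _ (by omega)]
  exact hstable k (by omega)
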